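/- Let $K$ be a field, $S=K[x_1,\dots,x_n]$, let $I\subset S$ be a monomial ideal with minimal set of monomial generators $G(I)$, and let $a=(a_1,\dots,a_n)$ be an integer vector with all $a_i\ge 0$. For integer vectors write $b\le a$ if $b_i\le a_i$ for all $i$, and let $I^{\le a}$ be the monomial ideal generated by all $x^b\in G(I)$ with $b\le a$. Let $$\mathbb F:\quad 0\to F_p\to F_{p-1}\to\cdots\to F_1\to F_0\to S/I\to 0,\qquad F_i=\bigoplus_j S(-q_{ij}),$$ be a multigraded (that is, $\mathbb Z^n$-graded) minimal free resolution of $S/I$ by finitely generated free modules, and let $\mathbb G$ be the subcomplex of $\mathbb F$ with $$G_i=\bigoplus_{j:\ q_{ij}\le a}S(-q_{ij}).$$ Then $\mathbb G$ is a multigraded minimal free resolution of $S/I^{\le a}$, with an augmentation $G_0\to S/I^{\le a}$ whose composition with the canonical map $S/I^{\le a}\to S/I$ is the restriction to $G_0$ of the augmentation $F_0\to S/I$. In particular, if $I$ has a linear resolution, then so does $I^{\le a}$. Here an ideal $J$ is said to have a linear resolution if there are an integer $d\ge 0$ and a minimal graded free resolution $\cdots\to F_1\to F_0\to S/J\to 0$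 of finite length by finitely generated free modules, for the standard grading $\deg x_i=1$, such that for every $i\ge 1$ all shifts of $F_i$ equal $d+i-1$ (that is, $F_i\cong S(-d-i+1)^{\beta_i}$, where $\beta_i=0$ is allowed). -/

import Mathlib

open MvPolynomial

noncomputable section

/-- A monomial ideal: an ideal generated by a set of monomials `x^b`. -/
def IsMonomialIdeal {K : Type*} [Field K] {n : ℕ} (I : Ideal (MvPolynomial (Fin n) K)) : Prop :=
  ∃ A : Set (Fin n →₀ ℕ), I = Ideal.span ((fun b => monomial b (1 : K)) '' A)

/-- The exponent vectors of the minimal monomial generators `G(I)` of a monomial ideal `I`: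
the monomials of `I` that are minimal under divisibility. -/
def minGenExponents {K : Type*} [Field K] {n : ℕ} (I : Ideal (MvPolynomial (Fin n) K)) :
    Set (Fin n →₀ ℕ) :=
  {b | Minimal (fun c => monomial c (1 : K) ∈ I) b}

/-- The ideal `I^{≤ a}`, generated by all `x^b ∈ G(I)` with `b ≤ a`. -/
def idealLE {K : Type*} [Field K] {n : ℕ} (I : Ideal (MvPolynomial (Fin n) K)) (a : Fin n → ℤ) :
    Ideal (MvPolynomial (Fin n) K) :=
  Ideal.span ((fun b => monomial b (1 : K)) ''
    {b | b ∈ minGenExponents I ∧ ∀ i, (b i : ℤ) ≤ a i})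

theorem idealLE_le {K : Type*} [Field K] {n : ℕ} (I : Ideal (MvPolynomial (Fin n) K))
    (a : Fin n → ℤ) : idealLE I a ≤ I := by
  refine Ideal.span_le.2 ?_
  rintro _ ⟨b, hb, rfl⟩
  exact hb.1.1

/-- An element `x` of the graded free module `⊕_j S(-q_j)` is homogeneous of degree `g`: its
`j`-th coordinate lies in `S(-q_j)_g = S_{g - q_j}`. Here `S = K[x_1, …, x_n]` is graded by giving
the variable `x_i` the degree `w i`. -/
def IsFreeHomogeneous {K : Type*} [Field K] {n : ℕ} {Γ : Type*} [AddCommGroup Γ] (w : Fin n → Γ)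
    {J : Type*} (q : J → Γ) (x : J →₀ MvPolynomial (Fin n) K) (g : Γ) : Prop :=
  ∀ j, IsWeightedHomogeneous w (x j) (g - q j)

/-- A complex `⋯ → F_2 → F_1 → F_0` of finitely generated graded free modules
`F_i = ⊕_{j ∈ ι i} S(-shift i j)` over `S = K[x_1, …, x_n]`, where `x_i` has degree `w i`,
with differentials that are homogeneous of degree `0`. -/
structure GradedFreeComplex (K : Type*) [Field K] {n : ℕ} {Γ : Type*} [AddCommGroup Γ]
    (w : Fin n → Γ) where
  ι : ℕ → Type
  finite_ι : ∀ i, Finite (ι i)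
  shift : ∀ i, ι i → Γ
  /-- the differential `F_{i+1} → F_i` -/
  d : ∀ i, (ι (i + 1) →₀ MvPolynomial (Fin n) K) →ₗ[MvPolynomial (Fin n) K]
    (ι i →₀ MvPolynomial (Fin n) K)
  d_comp_d : ∀ i, d i ∘ₗ d (i + 1) = 0
  d_homogeneous : ∀ i g x, IsFreeHomogeneous w (shift (i + 1)) x g →
    IsFreeHomogeneous w (shift i) (d i x) g

/-- With the augmentation `ε`, the complex `F` is a minimal graded free resolution
`0 → F_p → ⋯ → F_1 → F_0 → S/I → 0` of `S/I`. -/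
structure GradedFreeComplex.IsMinimalResolution {K : Type*} [Field K] {n : ℕ} {Γ : Type*}
    [AddCommGroup Γ] {w : Fin n → Γ} (F : GradedFreeComplex K w)
    (I : Ideal (MvPolynomial (Fin n) K))
    (ε : (F.ι 0 →₀ MvPolynomial (Fin n) K) →ₗ[MvPolynomial (Fin n) K]
      (MvPolynomial (Fin n) K ⧸ I)) : Prop where
  finite_length : ∃ p, ∀ i, p < i → IsEmpty (F.ι i)
  /-- the augmentation is homogeneous of degree `0` -/
  aug_homogeneous : ∀ g x, IsFreeHomogeneous w (F.shift 0) x g →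
    ∃ f, IsWeightedHomogeneous w f g ∧ Ideal.Quotient.mk I f = ε x
  aug_surjective : Function.Surjective ε
  exact_zero : Function.Exact (F.d 0) ε
  exact_succ : ∀ i, Function.Exact (F.d (i + 1)) (F.d i)
  /-- minimality: the image of each differential lies in `(x_1, …, x_n) F_i` -/
  minimal : ∀ i, LinearMap.range (F.d i) ≤
    idealOfVars (Fin n) K • (⊤ : Submodule (MvPolynomial (Fin n) K)
      (F.ι i →₀ MvPolynomial (Fin n) K))

/-- The weights of the fine (multi)grading: `x_i` has degree the `i`-th unit vector of `ℤ^n`. -/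
def multiWeight (n : ℕ) : Fin n → (Fin n → ℤ) := fun i => Pi.single i 1

/-- The weights of the standard grading: every variable has degree `1`. -/
def stdWeight (n : ℕ) : Fin n → ℤ := fun _ => 1

/-- `I` has a linear resolution: for some `d`, the minimal graded free resolution of `I` (for the
standard grading) has the shape `⋯ → S(-d-1)^{β_1} → S(-d)^{β_0} → I → 0`. In terms of the
resolution `F` of `S/I`, whose term `F_{i+1}` is the `i`-th term of the resolution of `I`, all
shifts of `F_{i+1}` are equal to `d + i`. -/
def HasLinearResolution {K : Type*} [Field K] {n : ℕ} (I : Ideal (MvPolynomial (Fin n) K)) :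
    Prop :=
  ∃ (d : ℕ) (F : GradedFreeComplex K (stdWeight n))
    (ε : (F.ι 0 →₀ MvPolynomial (Fin n) K) →ₗ[MvPolynomial (Fin n) K]
      (MvPolynomial (Fin n) K ⧸ I)),
    F.IsMinimalResolution I ε ∧ ∀ i j, F.shift (i + 1) j = (d : ℤ) + i

namespace GradedFreeComplex

variable {K : Type*} [Field K] {n : ℕ}

/-- The index set of the summands `S(-q_{ij})` of `F_i` with `q_{ij} ≤ a`. -/
abbrev leIdx (F : GradedFreeComplex K (multiWeight n)) (a : Fin n → ℤ) (i : ℕ) : Type :=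
  {j : F.ι i // F.shift i j ≤ a}

/-- The inclusion of `G_i = ⊕_{q_{ij} ≤ a} S(-q_{ij})` into `F_i`. -/
def inclLE (F : GradedFreeComplex K (multiWeight n)) (a : Fin n → ℤ) (i : ℕ) :
    (F.leIdx a i →₀ MvPolynomial (Fin n) K) →ₗ[MvPolynomial (Fin n) K]
      (F.ι i →₀ MvPolynomial (Fin n) K) :=
  Finsupp.lmapDomain _ _ Subtype.val

/-- The map `G_{i+1} → G_i` given by the entries of the matrix of `F_{i+1} → F_i`. -/
def dLE (F : GradedFreeComplex K (multiWeight n)) (a : Fin n → ℤ) (i : ℕ) :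
    (F.leIdx a (i + 1) →₀ MvPolynomial (Fin n) K) →ₗ[MvPolynomial (Fin n) K]
      (F.leIdx a i →₀ MvPolynomial (Fin n) K) :=
  Finsupp.lcomapDomain Subtype.val Subtype.val_injective ∘ₗ F.d i ∘ₗ F.inclLE a (i + 1)

theorem inclLE_apply (F : GradedFreeComplex K (multiWeight n)) (a : Fin n → ℤ) (i : ℕ)
    (x : F.leIdx a i →₀ MvPolynomial (Fin n) K) (j : F.leIdx a i) :
    F.inclLE a i x j.1 = x j :=
  Finsupp.mapDomain_apply Subtype.val_injective x j

theorem inclLE_apply_of_not_le (F : GradedFreeComplex K (multiWeight n)) (a : Fin n → ℤ) (i : ℕ)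
    (x : F.leIdx a i →₀ MvPolynomial (Fin n) K) (j : F.ι i) (hj : ¬ F.shift i j ≤ a) :
    F.inclLE a i x j = 0 :=
  Finsupp.mapDomain_of_notMem_range x j (by rintro ⟨k, rfl⟩; exact hj k.2)

theorem inclLE_injective (F : GradedFreeComplex K (multiWeight n)) (a : Fin n → ℤ) (i : ℕ) :
    Function.Injective (F.inclLE a i) :=
  Finsupp.mapDomain_injective Subtype.val_injective

theorem weight_multiWeight_nonneg (b : Fin n →₀ ℕ) :
    0 ≤ Finsupp.weight (multiWeight n) b := by
  rw [Finsupp.weight_apply]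
  refine Finset.sum_nonneg fun i _ => nsmul_nonneg ?_ _
  exact Pi.single_nonneg.2 zero_le_one

theorem isFreeHomogeneous_single {J : Type*} (q : J → Fin n → ℤ) (j : J) :
    IsFreeHomogeneous (multiWeight n) q
      (Finsupp.single j (1 : MvPolynomial (Fin n) K)) (q j) := by
  classical
  intro k
  rw [Finsupp.single_apply]
  split_ifs with h
  · subst h
    rw [sub_self]
    exact isWeightedHomogeneous_one _ _
  · exact isWeightedHomogeneous_zero _ _ _

/-- The differential of `F` maps `G_{i+1}` into `G_i`. -/
theorem d_inclLE_eq_zero (F : GradedFreeComplex K (multiWeight n)) (a : Fin n → ℤ) (i : ℕ)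
    (x : F.leIdx a (i + 1) →₀ MvPolynomial (Fin n) K) (k : F.ι i) (hk : ¬ F.shift i k ≤ a) :
    F.d i (F.inclLE a (i + 1) x) k = 0 := by
  induction x using Finsupp.induction_linear with
  | zero => simp
  | add f g hf hg => simp [hf, hg]
  | single j s =>
    have h1 : F.inclLE a (i + 1) (Finsupp.single j s) = s • Finsupp.single j.1 1 := by
      simp [inclLE]
    rw [h1, map_smul, Finsupp.smul_apply]
    suffices h : F.d i (Finsupp.single j.1 1) k = 0 by rw [h, smul_zero]
    have h2 := F.d_homogeneous i _ _ (isFreeHomogeneous_single (K := K) (F.shift (i + 1)) j.1) k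
    by_contra hne
    obtain ⟨b, hb⟩ := MvPolynomial.ne_zero_iff.1 hne
    have h3 := weight_multiWeight_nonneg b
    rw [h2 hb] at h3
    exact hk ((sub_nonneg.1 h3).trans j.2)

/-- The inclusions `G_i → F_i` commute with the differentials: `G` is a subcomplex of `F`. -/
theorem inclLE_dLE (F : GradedFreeComplex K (multiWeight n)) (a : Fin n → ℤ) (i : ℕ)
    (x : F.leIdx a (i + 1) →₀ MvPolynomial (Fin n) K) :
    F.inclLE a i (F.dLE a i x) = F.d i (F.inclLE a (i + 1) x) := by
  ext1 k
  by_cases hk : F.shift i k ≤ a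
  · exact F.inclLE_apply a i (F.dLE a i x) ⟨k, hk⟩
  · rw [F.inclLE_apply_of_not_le a i _ k hk, F.d_inclLE_eq_zero a i x k hk]

/-- The subcomplex `G` of `F` with `G_i = ⊕_{q_{ij} ≤ a} S(-q_{ij})`. -/
def restrictLE (F : GradedFreeComplex K (multiWeight n)) (a : Fin n → ℤ) :
    GradedFreeComplex K (multiWeight n) where
  ι := F.leIdx a
  finite_ι i := by
    have := F.finite_ι i
    infer_instance
  shift i j := F.shift i j.1
  d := F.dLE a
  d_comp_d i := by
    ext1 j
    ext1
    apply F.inclLE_injective a i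
    simp only [LinearMap.comp_apply, inclLE_dLE, LinearMap.zero_apply, map_zero]
    exact LinearMap.congr_fun (F.d_comp_d i) _
  d_homogeneous i g x hx k := by
    refine F.d_homogeneous i g (F.inclLE a (i + 1) x) (fun j => ?_) k.1
    by_cases hj : F.shift (i + 1) j ≤ a
    · rw [F.inclLE_apply a (i + 1) x ⟨j, hj⟩]
      exact hx ⟨j, hj⟩
    · rw [F.inclLE_apply_of_not_le a (i + 1) x j hj]
      exact isWeightedHomogeneous_zero _ _ _

end GradedFreeComplex

end

/-!
Two facts make the restricted complex `G` work. In a multidegree `g ≤ a` the complexes `G` and `F`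
coincide, as do the ideals `I^{≤ a}` and `I`. And as all shifts of `G` are `≤ a`, multiplication by
the monomial of degree `g - g ⊓ a` identifies the part of `G` in degree `g ⊓ a` with the part in
degree `g` (`IsFreeHomogeneous.exists_eq_monomial_smul`); likewise, for `g ≥ 0`, we have `x^g ∈
I^{≤ a}` if and only if `x^{g ⊓ a} ∈ I`. Hence exactness of `G` in any degree `g` follows from
exactness of `F` in degree `g ⊓ a` (`GradedFreeComplex.IsMinimalResolution.restrictLE`).

A linear resolution is only graded by total degree, so for the statement about linear resolutions
it has to be refined to a multigraded one first
(`GradedFreeComplex.IsMinimalResolution.exists_multigraded`). This is done in the given complex by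
changing bases, one homological degree after the other. If the bases of `F_0, …, F_i` have been
chosen, then the image of `F_{i+1} → F_i` is a multigraded submodule, and it is minimally generated
in the single total degree `d + i`. Its part in that degree is a multigraded vector space with
basis the images of the generators of `F_{i+1}`; a multihomogeneous basis of it differs from this
one by an invertible matrix over `K`, which provides the new basis of `F_{i+1}`
(`exists_multihomogeneous_generators`). The multigraded resolution is then restricted, and the
result is graded by total degree again.
-/

noncomputable section

/-! ### Homogeneous components in graded free modules -/

section Graded

variable {K : Type*} [Field K] {n : ℕ} {Γ : Type*} [AddCommGroup Γ] {w : Fin n → Γ}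
  {J : Type*} {q : J → Γ}

/-- The homogeneous component of degree `g` of an element of `⊕_j S(-q_j)`, taken coordinatewise;
it is only `K`-linear. -/
def freeComponent (w : Fin n → Γ) (q : J → Γ) (g : Γ) :
    (J →₀ MvPolynomial (Fin n) K) →ₗ[K] (J →₀ MvPolynomial (Fin n) K) where
  toFun x := Finsupp.onFinset x.support
    (fun j => weightedHomogeneousComponent w (g - q j) (x j)) (by
      intro j hj
      rw [Finsupp.mem_support_iff]
      rintro h
      simp [h] at hj)
  map_add' x y := by ext1 j; simp
  map_smul' c x := by ext1 j; simp

@[simp]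
theorem freeComponent_apply (g : Γ) (x : J →₀ MvPolynomial (Fin n) K) (j : J) :
    freeComponent w q g x j = weightedHomogeneousComponent w (g - q j) (x j) := rfl

theorem isFreeHomogeneous_freeComponent (g : Γ) (x : J →₀ MvPolynomial (Fin n) K) :
    IsFreeHomogeneous w q (freeComponent w q g x) g :=
  fun j => weightedHomogeneousComponent_isWeightedHomogeneous (g - q j) (x j)

theorem IsFreeHomogeneous.freeComponent_eq_self {g : Γ} {x : J →₀ MvPolynomial (Fin n) K}
    (hx : IsFreeHomogeneous w q x g) : freeComponent w q g x = x := by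
  ext1 j
  exact (hx j).weightedHomogeneousComponent_same

theorem IsFreeHomogeneous.freeComponent_eq_zero {g h : Γ} {x : J →₀ MvPolynomial (Fin n) K}
    (hx : IsFreeHomogeneous w q x h) (hne : h ≠ g) : freeComponent w q g x = 0 := by
  ext1 j
  exact (hx j).weightedHomogeneousComponent_ne _ (by simpa using hne.symm)

theorem exists_sum_freeComponent (w : Fin n → Γ) (q : J → Γ)
    (x : J →₀ MvPolynomial (Fin n) K) :
    ∃ T : Finset Γ, ∑ g ∈ T, freeComponent w q g x = x := by
  classical
  refine ⟨x.support.biUnion fun j =>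
    (x j).support.image fun b => Finsupp.weight w b + q j, ?_⟩
  ext j b
  simp only [Finsupp.finsetSum_apply, freeComponent_apply, coeff_sum,
    coeff_weightedHomogeneousComponent]
  by_cases hb : coeff b (x j) = 0
  · simp [hb]
  · have hj : x j ≠ 0 := by rintro h; simp [h] at hb
    simp_rw [eq_sub_iff_add_eq]
    rw [Finset.sum_ite_eq, if_pos]
    rw [Finset.mem_biUnion]
    exact ⟨j, Finsupp.mem_support_iff.2 hj,
      Finset.mem_image.2 ⟨b, mem_support_iff.2 hb, rfl⟩⟩

theorem mem_of_freeComponent_mem (w : Fin n → Γ) (q : J → Γ)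
    {P : AddSubmonoid (J →₀ MvPolynomial (Fin n) K)} {x : J →₀ MvPolynomial (Fin n) K}
    (h : ∀ g, freeComponent w q g x ∈ P) : x ∈ P := by
  obtain ⟨T, hT⟩ := exists_sum_freeComponent w q x
  rw [← hT]
  exact P.sum_mem fun g _ => h g

/-- A linear form that is homogeneous of degree `-s` commutes with taking components. -/
theorem weightedHomogeneousComponent_linearMap
    {L : (J →₀ MvPolynomial (Fin n) K) →ₗ[MvPolynomial (Fin n) K] MvPolynomial (Fin n) K} {s : Γ}
    (hL : ∀ g x, IsFreeHomogeneous w q x g → IsWeightedHomogeneous w (L x) (g - s))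
    (g : Γ) (x : J →₀ MvPolynomial (Fin n) K) :
    weightedHomogeneousComponent w (g - s) (L x) = L (freeComponent w q g x) := by
  let P := AddMonoidHom.eqLocusM
    ((weightedHomogeneousComponent w (g - s)).toAddMonoidHom.comp L.toAddMonoidHom)
    (L.toAddMonoidHom.comp (freeComponent w q g).toAddMonoidHom)
  refine mem_of_freeComponent_mem w q (P := P) (fun h => ?_)
  change weightedHomogeneousComponent w (g - s) (L (freeComponent w q h x)) =
    L (freeComponent w q g (freeComponent w q h x))
  have hx := isFreeHomogeneous_freeComponent (w := w) (q := q) h x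
  by_cases hg : h = g
  · subst hg
    rw [hx.freeComponent_eq_self, (hL _ _ hx).weightedHomogeneousComponent_same]
  · rw [hx.freeComponent_eq_zero hg, map_zero,
      (hL _ _ hx).weightedHomogeneousComponent_ne _ (by simpa using Ne.symm hg)]

theorem freeComponent_linearMap {J' : Type*} {q' : J' → Γ}
    {D : (J →₀ MvPolynomial (Fin n) K) →ₗ[MvPolynomial (Fin n) K] (J' →₀ MvPolynomial (Fin n) K)}
    (hD : ∀ g x, IsFreeHomogeneous w q x g → IsFreeHomogeneous w q' (D x) g)
    (g : Γ) (x : J →₀ MvPolynomial (Fin n) K) :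
    freeComponent w q' g (D x) = D (freeComponent w q g x) := by
  ext1 k
  exact weightedHomogeneousComponent_linearMap (L := Finsupp.lapply k ∘ₗ D) (s := q' k)
    (fun g x hx => hD g x hx k) g x

/-- Homogeneity of a linear form can be checked on the basis. -/
theorem isWeightedHomogeneous_linearMap
    {L : (J →₀ MvPolynomial (Fin n) K) →ₗ[MvPolynomial (Fin n) K] MvPolynomial (Fin n) K} {s : Γ}
    (hL : ∀ j, IsWeightedHomogeneous w (L (Finsupp.single j 1)) (q j - s))
    {g : Γ} {x : J →₀ MvPolynomial (Fin n) K} (hx : IsFreeHomogeneous w q x g) :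
    IsWeightedHomogeneous w (L x) (g - s) := by
  have h : L x = ∑ j ∈ x.support, x j * L (Finsupp.single j 1) := by
    conv_lhs => rw [← Finsupp.sum_single x, Finsupp.sum, map_sum]
    refine Finset.sum_congr rfl fun j _ => ?_
    rw [← smul_eq_mul, ← map_smul, Finsupp.smul_single, smul_eq_mul, mul_one]
  rw [h]
  refine IsWeightedHomogeneous.sum _ _ _ fun j _ => ?_
  have h2 := (hx j).mul (hL j)
  rwa [sub_add_sub_cancel] at h2

theorem isFreeHomogeneous_linearMap {J' : Type*} {q' : J' → Γ}
    {D : (J →₀ MvPolynomial (Fin n) K) →ₗ[MvPolynomial (Fin n) K] (J' →₀ MvPolynomial (Fin n) K)}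
    (hD : ∀ j, IsFreeHomogeneous w q' (D (Finsupp.single j 1)) (q j))
    {g : Γ} {x : J →₀ MvPolynomial (Fin n) K} (hx : IsFreeHomogeneous w q x g) :
    IsFreeHomogeneous w q' (D x) g := fun k =>
  isWeightedHomogeneous_linearMap (L := Finsupp.lapply k ∘ₗ D) (fun j => hD j k) hx

theorem isFreeHomogeneous_basis (w : Fin n → Γ) (q : J → Γ) (j : J) :
    IsFreeHomogeneous w q (Finsupp.single j (1 : MvPolynomial (Fin n) K)) (q j) := by
  classical
  intro k
  rw [Finsupp.single_apply]
  split_ifs with h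
  · subst h
    rw [sub_self]
    exact isWeightedHomogeneous_one _ _
  · exact isWeightedHomogeneous_zero _ _ _

/-- A homogeneous augmentation lifts to a homogeneous linear form. -/
theorem exists_homogeneous_lift {I : Ideal (MvPolynomial (Fin n) K)}
    (ε : (J →₀ MvPolynomial (Fin n) K) →ₗ[MvPolynomial (Fin n) K] (MvPolynomial (Fin n) K ⧸ I))
    (hε : ∀ g x, IsFreeHomogeneous w q x g →
      ∃ f, IsWeightedHomogeneous w f g ∧ Ideal.Quotient.mk I f = ε x) :
    ∃ φ : (J →₀ MvPolynomial (Fin n) K) →ₗ[MvPolynomial (Fin n) K] MvPolynomial (Fin n) K,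
      (∀ g x, IsFreeHomogeneous w q x g → IsWeightedHomogeneous w (φ x) g) ∧
      ∀ x, Ideal.Quotient.mk I (φ x) = ε x := by
  choose f hf hfε using fun j => hε _ _ (isFreeHomogeneous_basis (K := K) w q j)
  refine ⟨Finsupp.linearCombination _ f, fun g x hx => ?_, fun x => ?_⟩
  · rw [← sub_zero g]
    exact isWeightedHomogeneous_linearMap (s := 0) (fun j => by simpa using hf j) hx
  · induction x using Finsupp.induction_linear with
    | zero => simp
    | add x y hx hy => simp [hx, hy]
    | single j s =>
      have h : Finsupp.single j s = s • Finsupp.single j (1 : MvPolynomial (Fin n) K) := by simp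
      rw [h, map_smul ε, ← hfε, map_smul, Finsupp.linearCombination_single, one_smul, smul_eq_mul,
        map_mul]
      rfl

theorem constantCoeff_eq_zero_of_mem_smul_top {x : J →₀ MvPolynomial (Fin n) K}
    (hx : x ∈ idealOfVars (Fin n) K •
      (⊤ : Submodule (MvPolynomial (Fin n) K) (J →₀ MvPolynomial (Fin n) K))) (j : J) :
    constantCoeff (x j) = 0 := by
  induction hx using Submodule.smul_induction_on' with
  | smul r hr y _ =>
    have h : r ∈ RingHom.ker (constantCoeff : MvPolynomial (Fin n) K →+* K) := by
      refine (Ideal.span_le.2 ?_ : idealOfVars (Fin n) K ≤ _) hr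
      rintro _ ⟨i, rfl⟩
      simp
    simp [RingHom.mem_ker.1 h]
  | add x _ y _ hx hy => simp [hx, hy]

/-- Minimality is preserved by linear maps: they send `(x_1, …, x_n) M` into
`(x_1, …, x_n) N`. -/
theorem map_mem_smul_top {M N : Type*} [AddCommGroup M] [AddCommGroup N]
    [Module (MvPolynomial (Fin n) K) M] [Module (MvPolynomial (Fin n) K) N]
    (D : M →ₗ[MvPolynomial (Fin n) K] N) {x : M}
    (hx : x ∈ idealOfVars (Fin n) K • (⊤ : Submodule (MvPolynomial (Fin n) K) M)) :
    D x ∈ idealOfVars (Fin n) K • (⊤ : Submodule (MvPolynomial (Fin n) K) N) := by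
  have h := Submodule.mem_map_of_mem (f := D) hx
  rw [Submodule.map_smul''] at h
  exact Submodule.smul_mono le_rfl le_top h

end Graded

/-! ### The fine and the standard grading -/

section Weights

variable {K : Type*} [Field K] {n : ℕ} {J : Type*} {q : J → Fin n → ℤ}

theorem weight_multiWeight_apply (b : Fin n →₀ ℕ) (i : Fin n) :
    Finsupp.weight (multiWeight n) b i = b i := by
  classical
  rw [Finsupp.weight_apply, Finsupp.sum_fintype _ _ (by simp), Finset.sum_apply,
    Finset.sum_eq_single i]
  · simp [multiWeight]
  · intro k _ hk
    simp [multiWeight, hk.symm]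
  · simp

theorem weight_stdWeight (b : Fin n →₀ ℕ) :
    Finsupp.weight (stdWeight n) b = ∑ i, Finsupp.weight (multiWeight n) b i := by
  simp_rw [weight_multiWeight_apply]
  rw [Finsupp.weight_apply, Finsupp.sum_fintype _ _ (by simp)]
  simp [stdWeight]

theorem IsFreeHomogeneous.coarsen {x : J →₀ MvPolynomial (Fin n) K} {g : Fin n → ℤ}
    (hx : IsFreeHomogeneous (multiWeight n) q x g) :
    IsFreeHomogeneous (stdWeight n) (fun j => ∑ i, q j i) x (∑ i, g i) := by
  intro j b hb
  rw [weight_stdWeight, hx j hb]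
  simp

theorem IsFreeHomogeneous.sum_eq_of_ne_zero {x : J →₀ MvPolynomial (Fin n) K} {g : Fin n → ℤ}
    {e : ℤ} (hx : IsFreeHomogeneous (multiWeight n) q x g)
    (hx' : IsFreeHomogeneous (stdWeight n) (fun j => ∑ i, q j i) x e) (h0 : x ≠ 0) :
    ∑ i, g i = e := by
  obtain ⟨j, hj⟩ := Finsupp.ne_iff.1 h0
  simpa using (hx.coarsen j).inj_right hj (hx' j)

theorem IsFreeHomogeneous.freeComponent_multiWeight {x : J →₀ MvPolynomial (Fin n) K} {e : ℤ}
    {p : J → ℤ} (hx : IsFreeHomogeneous (stdWeight n) p x e) (g : Fin n → ℤ) :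
    IsFreeHomogeneous (stdWeight n) p (freeComponent (multiWeight n) q g x) e := by
  classical
  intro j b hb
  rw [freeComponent_apply, coeff_weightedHomogeneousComponent] at hb
  exact hx j fun h => hb (by simp [h])

/-- A polynomial of standard degree `0` is a constant. -/
theorem eq_C_of_isWeightedHomogeneous_stdWeight {f : MvPolynomial (Fin n) K}
    (hf : IsWeightedHomogeneous (stdWeight n) f 0) : f = C (constantCoeff f) := by
  classical
  ext b
  rw [coeff_C]
  split_ifs with h
  · subst h; rfl
  · by_contra hb
    have h1 := hf hb
    rw [weight_stdWeight] at h1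
    simp_rw [weight_multiWeight_apply] at h1
    rw [Finset.sum_eq_zero_iff_of_nonneg (fun i _ => Int.natCast_nonneg _)] at h1
    exact h (by ext i; exact_mod_cast (h1 i (Finset.mem_univ i)).symm)

end Weights

/-! ### Monomial ideals and their truncations -/

section MonomialIdeal

variable {K : Type*} [Field K] {n : ℕ} {I : Ideal (MvPolynomial (Fin n) K)} {a : Fin n → ℤ}

theorem IsMonomialIdeal.mem_iff (hI : IsMonomialIdeal I) (f : MvPolynomial (Fin n) K) :
    f ∈ I ↔ ∀ b, coeff b f ≠ 0 → monomial b (1 : K) ∈ I := by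
  classical
  obtain ⟨A, rfl⟩ := hI
  simp only [mem_ideal_span_monomial_image, mem_support_iff, coeff_monomial]
  simp

theorem IsMonomialIdeal.weightedHomogeneousComponent_mem (hI : IsMonomialIdeal I) {Γ : Type*}
    [AddCommGroup Γ] (w : Fin n → Γ) (g : Γ) {f : MvPolynomial (Fin n) K} (hf : f ∈ I) :
    weightedHomogeneousComponent w g f ∈ I := by
  classical
  rw [hI.mem_iff] at hf ⊢
  intro b hb
  rw [coeff_weightedHomogeneousComponent] at hb
  exact hf b fun h => hb (by simp [h])

/-- In degrees `≤ a`, the ideals `I` and `I^{≤ a}` agree. -/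
theorem IsMonomialIdeal.mem_idealLE (hI : IsMonomialIdeal I) {f : MvPolynomial (Fin n) K}
    {g : Fin n → ℤ} (hf : IsWeightedHomogeneous (multiWeight n) f g) (hg : g ≤ a) (hfI : f ∈ I) :
    f ∈ idealLE I a := by
  rw [idealLE, mem_ideal_span_monomial_image]
  intro b hb
  rw [mem_support_iff] at hb
  obtain ⟨c, hcb, hc⟩ := exists_minimal_le_of_wellFoundedLT
    (fun c => monomial c (1 : K) ∈ I) b ((hI.mem_iff f).1 hfI b hb)
  refine ⟨c, ⟨hc, fun i => ?_⟩, hcb⟩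
  have h1 := congrFun (hf hb) i
  rw [weight_multiWeight_apply] at h1
  have h2 : (c i : ℤ) ≤ b i := by exact_mod_cast hcb i
  exact h2.trans (h1.trans_le (hg i))

/-- Membership in `I^{≤ a}` in degree `g` is detected by `I` in degree `g ⊓ a`. -/
theorem IsMonomialIdeal.mem_of_monomial_mul_mem_idealLE (hI : IsMonomialIdeal I)
    {f : MvPolynomial (Fin n) K} {g : Fin n → ℤ} {e : Fin n →₀ ℕ}
    (hf : IsWeightedHomogeneous (multiWeight n) f (g ⊓ a))
    (he : ∀ i, (e i : ℤ) = g i - (g ⊓ a) i) (h : monomial e 1 * f ∈ idealLE I a) :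
    f ∈ I := by
  rw [idealLE, mem_ideal_span_monomial_image] at h
  rw [hI.mem_iff]
  intro b hb
  obtain ⟨c, ⟨hc, hca⟩, hcb⟩ := h (e + b) (by
    rw [mem_support_iff, coeff_monomial_mul, one_mul]; exact hb)
  have hle : c ≤ b := by
    intro i
    have h1 := congrFun (hf hb) i
    rw [weight_multiWeight_apply] at h1
    have h2 : (c i : ℤ) ≤ e i + b i := by exact_mod_cast hcb i
    have h3 := he i
    have h4 := hca i
    rw [Pi.inf_apply] at h1 h3
    have h5 : (c i : ℤ) ≤ b i := by
      rw [h1]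
      exact le_inf (by linarith) h4
    exact_mod_cast h5
  obtain ⟨d, rfl⟩ := exists_add_of_le hle
  have h6 := I.mul_mem_right (monomial d 1) hc.1
  rwa [monomial_mul, one_mul] at h6

end MonomialIdeal

/-! ### The restricted complex is a resolution -/

/-- If all shifts are `≤ a`, the part of `⊕_j S(-q_j)` in degree `g` is obtained from the part in
degree `g ⊓ a` through multiplication by the monomial of degree `g - g ⊓ a`. -/
theorem IsFreeHomogeneous.exists_eq_monomial_smul {K : Type*} [Field K] {n : ℕ} {J : Type*}
    {q : J → Fin n → ℤ} {a g : Fin n → ℤ} (hq : ∀ j, q j ≤ a)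
    {x : J →₀ MvPolynomial (Fin n) K} (hx : IsFreeHomogeneous (multiWeight n) q x g) :
    ∃ (e : Fin n →₀ ℕ) (y : J →₀ MvPolynomial (Fin n) K),
      (∀ i, (e i : ℤ) = g i - (g ⊓ a) i) ∧ IsFreeHomogeneous (multiWeight n) q y (g ⊓ a) ∧
      x = monomial e (1 : K) • y := by
  classical
  let e : Fin n →₀ ℕ := Finsupp.equivFunOnFinite.symm fun i => (g i - (g ⊓ a) i).toNat
  have he : ∀ i, (e i : ℤ) = g i - (g ⊓ a) i := fun i =>
    Int.toNat_of_nonneg (sub_nonneg.2 inf_le_left)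
  refine ⟨e, x.mapRange (fun f => f.divMonomial e) (zero_divMonomial e), he, ?_, ?_⟩
  · intro j b hb
    rw [Finsupp.mapRange_apply, coeff_divMonomial] at hb
    have h := hx j hb
    ext i
    have h1 := congrFun h i
    rw [weight_multiWeight_apply, Finsupp.add_apply, Nat.cast_add, he] at h1
    rw [weight_multiWeight_apply]
    simp only [Pi.sub_apply] at h1 ⊢
    linarith
  · ext1 j
    rw [Finsupp.smul_apply, Finsupp.mapRange_apply, smul_eq_mul]
    conv_lhs => rw [← divMonomial_add_modMonomial (x j) e]
    rw [add_eq_left]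
    ext b
    rw [coeff_zero]
    by_cases hb : e ≤ b
    · exact coeff_modMonomial_of_le _ hb
    · rw [coeff_modMonomial_of_not_le _ hb]
      by_contra hne
      refine hb fun i => ?_
      have h1 := congrFun (hx j hne) i
      rw [weight_multiWeight_apply, Pi.sub_apply] at h1
      have h2 : q j i ≤ (g ⊓ a) i := le_inf (by linarith [Int.natCast_nonneg (b i)]) (hq j i)
      have h3 := he i
      have h4 : (e i : ℤ) ≤ b i := by linarith
      exact_mod_cast h4

namespace GradedFreeComplex

variable {K : Type*} [Field K] {n : ℕ} (F : GradedFreeComplex K (multiWeight n)) (a : Fin n → ℤ)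

/-- The shifts of the summands of `G_i`. -/
abbrev shiftLE (i : ℕ) : F.leIdx a i → Fin n → ℤ := fun j => F.shift i j.1

theorem dLE_homogeneous (i : ℕ) (g : Fin n → ℤ) (x : F.leIdx a (i + 1) →₀ MvPolynomial (Fin n) K)
    (hx : IsFreeHomogeneous (multiWeight n) (F.shiftLE a (i + 1)) x g) :
    IsFreeHomogeneous (multiWeight n) (F.shiftLE a i) (F.dLE a i x) g :=
  (F.restrictLE a).d_homogeneous i g x hx

theorem isFreeHomogeneous_inclLE {i : ℕ} {x : F.leIdx a i →₀ MvPolynomial (Fin n) K}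
    {g : Fin n → ℤ} (hx : IsFreeHomogeneous (multiWeight n) (F.shiftLE a i) x g) :
    IsFreeHomogeneous (multiWeight n) (F.shift i) (F.inclLE a i x) g := by
  intro j
  by_cases hj : F.shift i j ≤ a
  · rw [F.inclLE_apply a i x ⟨j, hj⟩]
    exact hx ⟨j, hj⟩
  · rw [F.inclLE_apply_of_not_le a i x j hj]
    exact isWeightedHomogeneous_zero _ _ _

/-- In degrees `≤ a`, the subcomplex `G` is all of `F`. -/
theorem exists_inclLE_eq {i : ℕ} {x : F.ι i →₀ MvPolynomial (Fin n) K} {g : Fin n → ℤ}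
    (hx : IsFreeHomogeneous (multiWeight n) (F.shift i) x g) (hg : g ≤ a) :
    ∃ z, F.inclLE a i z = x := by
  refine ⟨Finsupp.comapDomain Subtype.val x Subtype.val_injective.injOn, ?_⟩
  ext1 j
  by_cases hj : F.shift i j ≤ a
  · exact F.inclLE_apply a i _ ⟨j, hj⟩
  · rw [F.inclLE_apply_of_not_le a i _ j hj]
    by_contra hne
    obtain ⟨b, hb⟩ := MvPolynomial.ne_zero_iff.1 (Ne.symm hne)
    have h := weight_multiWeight_nonneg b
    rw [hx j hb] at h
    exact hj ((sub_nonneg.1 h).trans hg)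

/-- In degrees `≤ a`, a boundary of `F` that lies in `G` is a boundary of `G`. -/
theorem mem_range_dLE {i : ℕ} {y : F.leIdx a i →₀ MvPolynomial (Fin n) K} {g : Fin n → ℤ}
    (hy : IsFreeHomogeneous (multiWeight n) (F.shiftLE a i) y g) (hg : g ≤ a)
    (h : F.inclLE a i y ∈ LinearMap.range (F.d i)) : y ∈ LinearMap.range (F.dLE a i) := by
  obtain ⟨z, hz⟩ := h
  obtain ⟨z', hz'⟩ := F.exists_inclLE_eq a
    (isFreeHomogeneous_freeComponent (w := multiWeight n) (q := F.shift (i + 1)) g z) hg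
  refine ⟨z', F.inclLE_injective a i ?_⟩
  rw [inclLE_dLE, hz', ← freeComponent_linearMap (F.d_homogeneous i), hz,
    (F.isFreeHomogeneous_inclLE a hy).freeComponent_eq_self]

theorem exact_dLE {i : ℕ} (h : Function.Exact (F.d (i + 1)) (F.d i)) :
    Function.Exact (F.dLE a (i + 1)) (F.dLE a i) := by
  intro x
  constructor
  · intro hx
    refine mem_of_freeComponent_mem (multiWeight n) (F.shiftLE a (i + 1))
      (P := (LinearMap.range (F.dLE a (i + 1))).toAddSubmonoid) (fun g => ?_)
    have hd : F.dLE a i (freeComponent (multiWeight n) (F.shiftLE a (i + 1)) g x) = 0 := by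
      rw [← freeComponent_linearMap (F.dLE_homogeneous a i), hx, map_zero]
    obtain ⟨e, y, -, hy, hxy⟩ := (isFreeHomogeneous_freeComponent (w := multiWeight n)
      (q := F.shiftLE a (i + 1)) g x).exists_eq_monomial_smul fun j => j.2
    change _ ∈ LinearMap.range (F.dLE a (i + 1))
    rw [hxy]
    refine Submodule.smul_mem _ _ (F.mem_range_dLE a hy inf_le_right ?_)
    rw [hxy, map_smul, smul_eq_zero, monomial_eq_zero] at hd
    refine (h _).1 ?_
    rw [← inclLE_dLE, hd.resolve_left one_ne_zero, map_zero]
  · rintro ⟨z, rfl⟩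
    exact LinearMap.congr_fun ((F.restrictLE a).d_comp_d i) z

theorem range_dLE_le_smul_top {i : ℕ}
    (h : LinearMap.range (F.d i) ≤ idealOfVars (Fin n) K • ⊤) :
    LinearMap.range (F.dLE a i) ≤ idealOfVars (Fin n) K • ⊤ := by
  rintro _ ⟨x, rfl⟩
  exact map_mem_smul_top (Finsupp.lcomapDomain Subtype.val Subtype.val_injective)
    (h ⟨F.inclLE a (i + 1) x, rfl⟩)

/-- The cokernel of `G_1 → G_0` is `S/I^{≤ a}`, expressed through a homogeneous lift `φ` of the
augmentation `F_0 → S/I`. -/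
theorem mem_idealLE_iff_mem_range_dLE {I : Ideal (MvPolynomial (Fin n) K)} (hI : IsMonomialIdeal I)
    {φ : (F.ι 0 →₀ MvPolynomial (Fin n) K) →ₗ[MvPolynomial (Fin n) K] MvPolynomial (Fin n) K}
    (hφ : ∀ g x, IsFreeHomogeneous (multiWeight n) (F.shift 0) x g →
      IsWeightedHomogeneous (multiWeight n) (φ x) g)
    (hexact : ∀ x, φ x ∈ I ↔ x ∈ LinearMap.range (F.d 0))
    (x : F.leIdx a 0 →₀ MvPolynomial (Fin n) K) :
    φ (F.inclLE a 0 x) ∈ idealLE I a ↔ x ∈ LinearMap.range (F.dLE a 0) := by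
  have hψ : ∀ g x, IsFreeHomogeneous (multiWeight n) (F.shiftLE a 0) x g →
      IsWeightedHomogeneous (multiWeight n) ((φ ∘ₗ F.inclLE a 0) x) g := fun g x hx =>
    hφ g _ (F.isFreeHomogeneous_inclLE a hx)
  constructor
  · intro hx
    refine mem_of_freeComponent_mem (multiWeight n) (F.shiftLE a 0)
      (P := (LinearMap.range (F.dLE a 0)).toAddSubmonoid) (fun g => ?_)
    change _ ∈ LinearMap.range (F.dLE a 0)
    have hc : (φ ∘ₗ F.inclLE a 0) (freeComponent (multiWeight n) (F.shiftLE a 0) g x) ∈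
        idealLE I a := by
      rw [← weightedHomogeneousComponent_linearMap (s := 0)
        (fun g x hx => by simpa using hψ g x hx)]
      exact IsMonomialIdeal.weightedHomogeneousComponent_mem ⟨_, rfl⟩ _ _ hx
    obtain ⟨e, y, he, hy, hxy⟩ := (isFreeHomogeneous_freeComponent (w := multiWeight n)
      (q := F.shiftLE a 0) g x).exists_eq_monomial_smul fun j => j.2
    rw [hxy] at hc ⊢
    rw [map_smul, smul_eq_mul] at hc
    exact Submodule.smul_mem _ _ (F.mem_range_dLE a hy inf_le_right
      ((hexact _).1 (hI.mem_of_monomial_mul_mem_idealLE (hψ _ _ hy) he hc)))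
  · rintro ⟨z, rfl⟩
    let D := φ ∘ₗ F.inclLE a 0 ∘ₗ F.dLE a 0
    refine mem_of_freeComponent_mem (multiWeight n) (F.shiftLE a 1)
      (P := (Submodule.comap D (idealLE I a)).toAddSubmonoid) (fun g => ?_)
    change D _ ∈ idealLE I a
    obtain ⟨e, y, -, hy, hxy⟩ := (isFreeHomogeneous_freeComponent (w := multiWeight n)
      (q := F.shiftLE a 1) g z).exists_eq_monomial_smul fun j => j.2
    rw [hxy, map_smul]
    refine Submodule.smul_mem _ _ (hI.mem_idealLE
      (hψ _ _ (F.dLE_homogeneous a 0 _ _ hy)) inf_le_right ((hexact _).2 ?_))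
    rw [LinearMap.comp_apply, inclLE_dLE]
    exact ⟨_, rfl⟩

/-- Since `0 ≤ a`, an element of degree `0` over `1 ∈ S/I` lies in `G_0`, and maps to
`1 ∈ S/I^{≤ a}`. -/
theorem exists_sub_one_mem_idealLE {I : Ideal (MvPolynomial (Fin n) K)} (hI : IsMonomialIdeal I)
    (ha : 0 ≤ a)
    {φ : (F.ι 0 →₀ MvPolynomial (Fin n) K) →ₗ[MvPolynomial (Fin n) K] MvPolynomial (Fin n) K}
    (hφ : ∀ g x, IsFreeHomogeneous (multiWeight n) (F.shift 0) x g →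
      IsWeightedHomogeneous (multiWeight n) (φ x) g)
    {x : F.ι 0 →₀ MvPolynomial (Fin n) K} (hx : φ x - 1 ∈ I) :
    ∃ z, φ (F.inclLE a 0 z) - 1 ∈ idealLE I a := by
  obtain ⟨z, hz⟩ := F.exists_inclLE_eq a
    (isFreeHomogeneous_freeComponent (w := multiWeight n) (q := F.shift 0) 0 x) ha
  have h1 := weightedHomogeneousComponent_linearMap (w := multiWeight n) (q := F.shift 0)
    (L := φ) (s := 0) (fun g x hx => by simpa using hφ g x hx) 0 x
  have h2 : φ (F.inclLE a 0 z) - 1 =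
      weightedHomogeneousComponent (multiWeight n) 0 (φ x - 1) := by
    rw [sub_zero] at h1
    rw [map_sub, h1, (isWeightedHomogeneous_one K _).weightedHomogeneousComponent_same, hz]
  refine ⟨z, ?_⟩
  rw [h2]
  exact hI.mem_idealLE (weightedHomogeneousComponent_isWeightedHomogeneous 0 _) ha
    (hI.weightedHomogeneousComponent_mem _ _ hx)

theorem IsMinimalResolution.restrictLE {F : GradedFreeComplex K (multiWeight n)}
    {I : Ideal (MvPolynomial (Fin n) K)} (hI : IsMonomialIdeal I) {a : Fin n → ℤ} (ha : 0 ≤ a)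
    {ε : (F.ι 0 →₀ MvPolynomial (Fin n) K) →ₗ[MvPolynomial (Fin n) K] (MvPolynomial (Fin n) K ⧸ I)}
    (hF : F.IsMinimalResolution I ε) :
    ∃ η : ((F.restrictLE a).ι 0 →₀ MvPolynomial (Fin n) K) →ₗ[MvPolynomial (Fin n) K]
        (MvPolynomial (Fin n) K ⧸ idealLE I a),
      (F.restrictLE a).IsMinimalResolution (idealLE I a) η ∧
      ∀ x, Ideal.Quotient.factor (idealLE_le I a) (η x) = ε (F.inclLE a 0 x) := by
  obtain ⟨φ, hφ, hφε⟩ := exists_homogeneous_lift ε hF.aug_homogeneous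
  have hexact : ∀ x, φ x ∈ I ↔ x ∈ LinearMap.range (F.d 0) := fun x => by
    rw [← Ideal.Quotient.eq_zero_iff_mem, hφε]
    exact hF.exact_zero x
  let η : (F.leIdx a 0 →₀ MvPolynomial (Fin n) K) →ₗ[MvPolynomial (Fin n) K]
    (MvPolynomial (Fin n) K ⧸ idealLE I a) := (idealLE I a).mkQ ∘ₗ φ ∘ₗ F.inclLE a 0
  have hη : ∀ x, η x = Ideal.Quotient.mk (idealLE I a) (φ (F.inclLE a 0 x)) := fun x => rfl
  have hsurj : Function.Surjective η := by
    obtain ⟨x, hx⟩ := hF.aug_surjective 1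
    obtain ⟨z, hz⟩ := F.exists_sub_one_mem_idealLE a hI ha hφ (x := x) (by
      rw [← Ideal.Quotient.eq_zero_iff_mem, map_sub, hφε, hx, map_one, sub_self])
    rw [← Ideal.Quotient.eq, map_one, ← hη] at hz
    intro y
    obtain ⟨f, rfl⟩ := Ideal.Quotient.mk_surjective y
    refine ⟨f • z, ?_⟩
    rw [map_smul, hz]
    exact mul_one (Ideal.Quotient.mk (idealLE I a) f)
  have hzero : Function.Exact (F.dLE a 0) η := fun x => by
    rw [hη, Ideal.Quotient.eq_zero_iff_mem]
    exact F.mem_idealLE_iff_mem_range_dLE a hI hφ hexact x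
  refine ⟨η, ⟨?_, ?_, hsurj, hzero, fun i => F.exact_dLE a (hF.exact_succ i),
    fun i => F.range_dLE_le_smul_top a (hF.minimal i)⟩, fun x => ?_⟩
  · obtain ⟨p, hp⟩ := hF.finite_length
    exact ⟨p, fun i hi => ⟨fun j => (hp i hi).false j.1⟩⟩
  · exact fun g x hx => ⟨_, hφ g _ (F.isFreeHomogeneous_inclLE a hx), rfl⟩
  · rw [← hφε]
    rfl

end GradedFreeComplex

/-! ### Changes of basis over the ground field -/

section ConstantMaps

variable {K : Type*} [Field K] {n : ℕ} {J : Type*}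

/-- The inclusion of the vectors with constant coordinates. -/
def constVec (K : Type*) [Field K] (n : ℕ) (J : Type*) :
    (J →₀ K) →ₗ[K] (J →₀ MvPolynomial (Fin n) K) :=
  Finsupp.mapRange.linearMap (Algebra.linearMap K (MvPolynomial (Fin n) K))

@[simp]
theorem constVec_apply (c : J →₀ K) (j : J) : constVec K n J c j = C (c j) := rfl

theorem constVec_single (j : J) (r : K) :
    constVec K n J (Finsupp.single j r) = Finsupp.single j (C r) := by
  classical
  ext1 k
  rw [constVec_apply, Finsupp.single_apply, Finsupp.single_apply]
  split_ifs <;> simp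

theorem linearCombination_eq_apply_constVec {M : Type*} [AddCommGroup M] [Module K M]
    [Module (MvPolynomial (Fin n) K) M] [IsScalarTower K (MvPolynomial (Fin n) K) M]
    (D : (J →₀ MvPolynomial (Fin n) K) →ₗ[MvPolynomial (Fin n) K] M) (c : J →₀ K) :
    Finsupp.linearCombination K (fun j => D (Finsupp.single j 1)) c = D (constVec K n J c) := by
  induction c using Finsupp.induction_linear with
  | zero => simp
  | add x y hx hy => simp [hx, hy]
  | single j r =>
    have h : Finsupp.single j (C r : MvPolynomial (Fin n) K) =
        (C r : MvPolynomial (Fin n) K) • Finsupp.single j 1 := by simp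
    rw [constVec_single, h, map_smul, Finsupp.linearCombination_single, ← algebraMap_eq,
      algebraMap_smul]

/-- The extension of a `K`-linear map `K^J → K^J` to an `S`-linear map `S^J → S^J`. -/
def constMap (n : ℕ) (T : (J →₀ K) →ₗ[K] (J →₀ K)) :
    (J →₀ MvPolynomial (Fin n) K) →ₗ[MvPolynomial (Fin n) K] (J →₀ MvPolynomial (Fin n) K) :=
  Finsupp.linearCombination _ fun j => constVec K n J (T (Finsupp.single j 1))

theorem constMap_single (T : (J →₀ K) →ₗ[K] (J →₀ K)) (j : J) :
    constMap n T (Finsupp.single j 1) = constVec K n J (T (Finsupp.single j 1)) := by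
  rw [constMap, Finsupp.linearCombination_single, one_smul]

theorem constMap_constVec (T : (J →₀ K) →ₗ[K] (J →₀ K)) (c : J →₀ K) :
    constMap n T (constVec K n J c) = constVec K n J (T c) := by
  rw [← linearCombination_eq_apply_constVec]
  simp_rw [constMap_single]
  induction c using Finsupp.induction_linear with
  | zero => simp
  | add x y hx hy => simp [hx, hy]
  | single j r =>
    rw [Finsupp.linearCombination_single, ← map_smul, ← map_smul, Finsupp.smul_single,
      smul_eq_mul, mul_one]

theorem constMap_comp_constMap {T U : (J →₀ K) →ₗ[K] (J →₀ K)} (h : T ∘ₗ U = LinearMap.id) :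
    constMap n T ∘ₗ constMap n U = LinearMap.id := by
  ext1 j
  ext1
  simp only [LinearMap.comp_apply, Finsupp.lsingle_apply, LinearMap.id_apply]
  rw [constMap_single, constMap_constVec, ← LinearMap.comp_apply T U, h, LinearMap.id_apply,
    constVec_single, C_1]

/-- The automorphism of `S^J` given by an automorphism of `K^J`. -/
def constEquiv (n : ℕ) (T : (J →₀ K) ≃ₗ[K] (J →₀ K)) :
    (J →₀ MvPolynomial (Fin n) K) ≃ₗ[MvPolynomial (Fin n) K] (J →₀ MvPolynomial (Fin n) K) :=
  LinearEquiv.ofLinearMap (constMap n T) (constMap n T.symm)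
    (constMap_comp_constMap (by ext1; simp)) (constMap_comp_constMap (by ext1; simp))

theorem isFreeHomogeneous_constVec {Γ : Type*} [AddCommGroup Γ] (w : Fin n → Γ) {p : J → Γ} {e : Γ}
    (hp : ∀ j, p j = e) (c : J →₀ K) : IsFreeHomogeneous w p (constVec K n J c) e := by
  intro j
  rw [hp, sub_self, constVec_apply]
  exact isWeightedHomogeneous_C _ _

theorem isFreeHomogeneous_constMap {Γ : Type*} [AddCommGroup Γ] (w : Fin n → Γ) {p : J → Γ} {e : Γ}
    (hp : ∀ j, p j = e) (T : (J →₀ K) →ₗ[K] (J →₀ K)) {g : Γ}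
    {x : J →₀ MvPolynomial (Fin n) K} (hx : IsFreeHomogeneous w p x g) :
    IsFreeHomogeneous w p (constMap n T x) g :=
  isFreeHomogeneous_linearMap (fun j => by
    rw [constMap_single, hp]; exact isFreeHomogeneous_constVec w hp _) hx

theorem IsFreeHomogeneous.eq_constVec {p : J → ℤ} {e : ℤ} (hp : ∀ j, p j = e)
    {x : J →₀ MvPolynomial (Fin n) K} (hx : IsFreeHomogeneous (stdWeight n) p x e) :
    ∃ c, x = constVec K n J c := by
  refine ⟨x.mapRange constantCoeff (map_zero _), ?_⟩
  ext1 j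
  rw [constVec_apply, Finsupp.mapRange_apply]
  refine eq_C_of_isWeightedHomogeneous_stdWeight ?_
  simpa [hp] using hx j

end ConstantMaps

/-! ### Refining a linear resolution to a multigraded one -/

section Refine

variable {K : Type*} [Field K] {n : ℕ}

/-- A minimal system of generators, all of the same standard degree `e`, of a multigraded
submodule can be replaced by a multihomogeneous one through a change of basis over `K`: the
part of degree `e` of the submodule is spanned by its multihomogeneous elements, so that it has a
basis consisting of such elements. -/
theorem exists_multihomogeneous_generators {J J' : Type*} {p : J → ℤ} {p' : J' → ℤ} {e : ℤ}
    (hp' : ∀ j, p' j = e)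
    (D : (J' →₀ MvPolynomial (Fin n) K) →ₗ[MvPolynomial (Fin n) K] (J →₀ MvPolynomial (Fin n) K))
    (hD : ∀ g x, IsFreeHomogeneous (stdWeight n) p' x g → IsFreeHomogeneous (stdWeight n) p (D x) g)
    (hmin : LinearMap.ker D ≤ idealOfVars (Fin n) K • ⊤)
    {q : J → Fin n → ℤ} (hq : ∀ j, ∑ i, q j i = p j)
    (hcomp : ∀ g, ∀ x ∈ LinearMap.range D,
      freeComponent (multiWeight n) q g x ∈ LinearMap.range D) :
    ∃ (θ : (J' →₀ MvPolynomial (Fin n) K) ≃ₗ[MvPolynomial (Fin n) K]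
        (J' →₀ MvPolynomial (Fin n) K)) (q' : J' → Fin n → ℤ),
      (∀ j, ∑ i, q' j i = p' j) ∧
      (∀ g x, IsFreeHomogeneous (stdWeight n) p' x g →
        IsFreeHomogeneous (stdWeight n) p' (θ x) g) ∧
      ∀ g x, IsFreeHomogeneous (multiWeight n) q' x g →
        IsFreeHomogeneous (multiWeight n) q (D (θ.symm x)) g := by
  obtain rfl : (fun j => ∑ i, q j i) = p := funext hq
  let b : J' → (J →₀ MvPolynomial (Fin n) K) := fun k => D (Finsupp.single k 1)
  have hlc : ∀ c : J' →₀ K, Finsupp.linearCombination K b c = D (constVec K n J' c) :=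
    linearCombination_eq_apply_constVec D
  have hb : LinearIndependent K b := by
    rw [linearIndependent_iff]
    intro c hc
    rw [hlc] at hc
    ext1 k
    simpa using constantCoeff_eq_zero_of_mem_smul_top (hmin hc) k
  let N := Submodule.span K (Set.range b)
  -- `N` is the part of standard degree `e` of the range of `D`.
  have hN : ∀ x, x ∈ N ↔ x ∈ LinearMap.range D ∧
      IsFreeHomogeneous (stdWeight n) (fun j => ∑ i, q j i) x e := by
    intro x
    rw [Finsupp.mem_span_range_iff_exists_finsupp]
    constructor
    · rintro ⟨c, rfl⟩
      have h := hlc c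
      rw [Finsupp.linearCombination_apply] at h
      rw [h]
      exact ⟨⟨_, rfl⟩, hD _ _ (isFreeHomogeneous_constVec _ hp' c)⟩
    · rintro ⟨⟨y, rfl⟩, hx⟩
      obtain ⟨c, hc⟩ := (isFreeHomogeneous_freeComponent (w := stdWeight n) (q := p')
        e y).eq_constVec hp'
      refine ⟨c, ?_⟩
      rw [← Finsupp.linearCombination_apply, hlc, ← hc, ← freeComponent_linearMap hD,
        hx.freeComponent_eq_self]
  let H : Set (J →₀ MvPolynomial (Fin n) K) :=
    {x | x ∈ N ∧ ∃ g, IsFreeHomogeneous (multiWeight n) q x g}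
  have hH : Submodule.span K H = N := by
    refine le_antisymm (Submodule.span_le.2 fun x hx => hx.1) fun x hx => ?_
    refine mem_of_freeComponent_mem (multiWeight n) q
      (P := (Submodule.span K H).toAddSubmonoid) fun g => ?_
    refine Submodule.subset_span ⟨?_, g, isFreeHomogeneous_freeComponent g x⟩
    rw [hN] at hx ⊢
    exact ⟨hcomp g x hx.1, hx.2.freeComponent_multiWeight g⟩
  obtain ⟨B, hBH, hBspan, hB⟩ := exists_linearIndependent K H
  have hBN : Submodule.span K (Set.range ((↑) : B → (J →₀ MvPolynomial (Fin n) K))) = N := by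
    rw [Subtype.range_coe, hBspan, hH]
  let b' : Module.Basis J' K N := Module.Basis.span hb
  let v₀ : Module.Basis B K N := (Module.Basis.span hB).map (LinearEquiv.ofEq _ _ hBN)
  let v : Module.Basis J' K N := v₀.reindex (v₀.indexEquiv b')
  have hvB : ∀ j, (v j : J →₀ MvPolynomial (Fin n) K) ∈ H := by
    intro j
    have h : (v j : J →₀ MvPolynomial (Fin n) K) = ((v₀.indexEquiv b').symm j : B) := by
      simp [v, v₀, Module.Basis.span_apply]
    rw [h]
    exact hBH (Subtype.coe_prop _)
  -- `T` expresses the multihomogeneous basis `v` of `N` through the given one.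
  choose q' hq' using fun j => (hvB j).2
  let T : (J' →₀ K) ≃ₗ[K] (J' →₀ K) := v.repr.symm ≪≫ₗ b'.repr
  have hT : ∀ j, D (constVec K n J' (T (Finsupp.single j 1))) = v j := by
    intro j
    have h1 : T (Finsupp.single j 1) = b'.repr (v j) := by simp [T]
    have h2 := congrArg N.subtype (b'.linearCombination_repr (v j))
    rw [Finsupp.apply_linearCombination] at h2
    have h3 : N.subtype ∘ b' = b := by
      ext1 k
      exact congrArg Subtype.val (Module.Basis.span_apply hb k)
    rw [h3] at h2
    rw [h1, ← hlc]
    exact h2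
  refine ⟨constEquiv n T.symm, q', fun j => ?_, fun g x hx => ?_, fun g x hx => ?_⟩
  · rw [hp']
    exact (hq' j).sum_eq_of_ne_zero ((hN _).1 (v j).2).2 fun h => v.ne_zero j (Subtype.ext h)
  · exact isFreeHomogeneous_constMap _ hp' _ hx
  · refine isFreeHomogeneous_linearMap (D := D ∘ₗ constMap n T.toLinearMap) (fun j => ?_) hx
    rw [LinearMap.comp_apply, constMap_single]
    have h := hq' j
    rw [← hT j] at h
    exact h

namespace GradedFreeComplex

/-- A refinement in homological degree `i` of the standard grading of a complex `F` to a
multigrading: a new basis of `F_i`, given by a coordinate change `θ`, with multidegrees `q`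
such that the image of `F_{i+1} → F_i` becomes a multigraded submodule. -/
structure Refinement (F : GradedFreeComplex K (stdWeight n)) (i : ℕ) where
  θ : (F.ι i →₀ MvPolynomial (Fin n) K) ≃ₗ[MvPolynomial (Fin n) K]
    (F.ι i →₀ MvPolynomial (Fin n) K)
  q : F.ι i → Fin n → ℤ
  sum_q : ∀ j, ∑ l, q j l = F.shift i j
  θ_homogeneous : ∀ g x, IsFreeHomogeneous (stdWeight n) (F.shift i) x g →
    IsFreeHomogeneous (stdWeight n) (F.shift i) (θ x) g
  freeComponent_mem : ∀ g, ∀ x ∈ LinearMap.range (θ.toLinearMap ∘ₗ F.d i),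
    freeComponent (multiWeight n) q g x ∈ LinearMap.range (θ.toLinearMap ∘ₗ F.d i)

theorem Refinement.exists_succ {F : GradedFreeComplex K (stdWeight n)} {i : ℕ}
    (hexact : Function.Exact (F.d (i + 1)) (F.d i))
    (hmin : LinearMap.range (F.d (i + 1)) ≤ idealOfVars (Fin n) K • ⊤)
    {e : ℤ} (he : ∀ j, F.shift (i + 1) j = e) (s : F.Refinement i) :
    ∃ t : F.Refinement (i + 1), ∀ g x, IsFreeHomogeneous (multiWeight n) t.q x g →
      IsFreeHomogeneous (multiWeight n) s.q (s.θ (F.d i (t.θ.symm x))) g := by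
  obtain ⟨θ, q, hq, hθ, hD⟩ := exists_multihomogeneous_generators he
    (s.θ.toLinearMap ∘ₗ F.d i)
    (fun g x hx => s.θ_homogeneous g _ (F.d_homogeneous i g x hx))
    (fun x hx => hmin ((hexact x).1 (by simpa using hx)))
    s.sum_q s.freeComponent_mem
  refine ⟨⟨θ, q, hq, hθ, fun g x hx => ?_⟩, hD⟩
  have hker : ∀ x, x ∈ LinearMap.range (θ.toLinearMap ∘ₗ F.d (i + 1)) ↔
      ((s.θ.toLinearMap ∘ₗ F.d i) ∘ₗ θ.symm.toLinearMap) x = 0 := by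
    intro x
    simp only [LinearMap.comp_apply, LinearEquiv.coe_coe, EmbeddingLike.map_eq_zero_iff]
    rw [hexact]
    constructor
    · rintro ⟨y, rfl⟩
      exact ⟨y, by simp⟩
    · rintro ⟨y, hy⟩
      exact ⟨y, by simp [hy]⟩
  rw [hker] at hx ⊢
  rw [← freeComponent_linearMap hD, hx, map_zero]

/-- By minimality, the generators of `F_0` have degree `0`. -/
theorem IsMinimalResolution.shift_zero {F : GradedFreeComplex K (stdWeight n)}
    {I : Ideal (MvPolynomial (Fin n) K)}
    {ε : (F.ι 0 →₀ MvPolynomial (Fin n) K) →ₗ[MvPolynomial (Fin n) K] (MvPolynomial (Fin n) K ⧸ I)}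
    (hF : F.IsMinimalResolution I ε) (k : F.ι 0) : F.shift 0 k = 0 := by
  by_contra hk
  -- If `e_k` had nonzero degree, then `ε e_k` would be the class of some `f` without constant term,
  -- and for `ε x = 1` the `k`-th coordinate of `e_k - f x ∈ ker ε` would have constant term `1`.
  obtain ⟨x, hx⟩ := hF.aug_surjective 1
  obtain ⟨f, hf, hfε⟩ := hF.aug_homogeneous _ _ (isFreeHomogeneous_basis _ (F.shift 0) k)
  have hf0 : constantCoeff f = 0 := hf.coeff_eq_zero 0 (by simpa using Ne.symm hk)
  have h1 : ε (Finsupp.single k 1 - f • x) = 0 := by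
    rw [map_sub, map_smul, hx, ← hfε, sub_eq_zero]
    exact (mul_one (Ideal.Quotient.mk I f)).symm
  have h2 := constantCoeff_eq_zero_of_mem_smul_top
    (hF.minimal 0 ((hF.exact_zero _).1 h1)) k
  simp [hf0] at h2

/-- A linear resolution of a monomial ideal comes from a multigraded minimal resolution. -/
theorem IsMinimalResolution.exists_multigraded {F : GradedFreeComplex K (stdWeight n)}
    {I : Ideal (MvPolynomial (Fin n) K)} (hI : IsMonomialIdeal I)
    {ε : (F.ι 0 →₀ MvPolynomial (Fin n) K) →ₗ[MvPolynomial (Fin n) K] (MvPolynomial (Fin n) K ⧸ I)}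
    (hF : F.IsMinimalResolution I ε) {d : ℤ} (hlin : ∀ i j, F.shift (i + 1) j = d + i) :
    ∃ (E : GradedFreeComplex K (multiWeight n))
      (ε' : (E.ι 0 →₀ MvPolynomial (Fin n) K) →ₗ[MvPolynomial (Fin n) K]
        (MvPolynomial (Fin n) K ⧸ I)),
      E.IsMinimalResolution I ε' ∧ ∀ i j, ∑ l, E.shift (i + 1) j l = d + i := by
  obtain ⟨φ, hφ, hφε⟩ := exists_homogeneous_lift ε hF.aug_homogeneous
  -- The generators of `F_0` are mapped to constants, so that they can be given multidegree `0`.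
  have hφm : ∀ g x, IsFreeHomogeneous (multiWeight n) (0 : F.ι 0 → Fin n → ℤ) x g →
      IsWeightedHomogeneous (multiWeight n) (φ x) g := by
    intro g x hx
    rw [← sub_zero g]
    refine isWeightedHomogeneous_linearMap (fun j => ?_) hx
    have h := hφ _ _ (isFreeHomogeneous_basis _ (F.shift 0) j)
    rw [hF.shift_zero] at h
    rw [eq_C_of_isWeightedHomogeneous_stdWeight h, Pi.zero_apply, sub_zero]
    exact isWeightedHomogeneous_C _ _
  have hφI : ∀ x, x ∈ LinearMap.range (F.d 0) ↔ φ x ∈ I := fun x => by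
    rw [← Ideal.Quotient.eq_zero_iff_mem, hφε]
    exact (hF.exact_zero x).symm
  let s₀ : F.Refinement 0 :=
    { θ := LinearEquiv.refl _ _
      q := 0
      sum_q := fun j => by simp [hF.shift_zero]
      θ_homogeneous := fun g x hx => hx
      freeComponent_mem := fun g x hx => by
        change _ ∈ LinearMap.range (F.d 0)
        rw [hφI]
        have h := weightedHomogeneousComponent_linearMap (w := multiWeight n) (L := φ) (s := 0)
          (fun g x hx => by simpa using hφm g x hx) g x
        rw [← h]
        exact hI.weightedHomogeneousComponent_mem _ _ ((hφI x).1 hx) }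
  choose next hnext using fun i (s : F.Refinement i) =>
    s.exists_succ (hF.exact_succ i) (hF.minimal (i + 1)) (hlin i)
  obtain ⟨s, hs₀, hs⟩ : ∃ s : ∀ i, F.Refinement i, s 0 = s₀ ∧ ∀ i, s (i + 1) = next i (s i) :=
    ⟨fun i => Nat.rec s₀ next i, rfl, fun i => rfl⟩
  have hdd : ∀ i x, F.d i (F.d (i + 1) x) = 0 := fun i x => LinearMap.congr_fun (F.d_comp_d i) x
  let E : GradedFreeComplex K (multiWeight n) :=
    { ι := F.ι
      finite_ι := F.finite_ι
      shift := fun i => (s i).q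
      d := fun i => (s i).θ.toLinearMap ∘ₗ F.d i ∘ₗ (s (i + 1)).θ.symm.toLinearMap
      d_comp_d := fun i => by
        refine LinearMap.ext fun x => ?_
        simp [hdd]
      d_homogeneous := fun i g x hx => by
        have h := hnext i (s i) g x
        rw [← hs] at h
        exact h hx }
  have hEd : ∀ i x, E.d i x = (s i).θ (F.d i ((s (i + 1)).θ.symm x)) := fun i x => rfl
  refine ⟨E, ε ∘ₗ (s 0).θ.symm.toLinearMap, ⟨hF.finite_length, fun g x hx => ?_, ?_, ?_, ?_, ?_⟩,
    fun i j => ((s (i + 1)).sum_q j).trans (hlin i j)⟩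
  · change IsFreeHomogeneous (multiWeight n) (s 0).q x g at hx
    rw [hs₀] at hx ⊢
    exact ⟨φ x, hφm g x hx, hφε x⟩
  · exact hF.aug_surjective.comp (s 0).θ.symm.surjective
  · intro x
    change ε ((s 0).θ.symm x) = 0 ↔ _
    rw [hF.exact_zero]
    constructor
    · rintro ⟨y, hy⟩
      exact ⟨(s 1).θ y, by simp [hEd, hy]⟩
    · rintro ⟨y, rfl⟩
      exact ⟨(s 1).θ.symm y, by simp [hEd]⟩
  · intro i x
    rw [hEd, EmbeddingLike.map_eq_zero_iff, hF.exact_succ]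
    constructor
    · rintro ⟨y, hy⟩
      exact ⟨(s (i + 2)).θ y, by simp [hEd, hy]⟩
    · rintro ⟨y, rfl⟩
      exact ⟨(s (i + 2)).θ.symm y, by simp [hEd]⟩
  · rintro i _ ⟨x, rfl⟩
    exact map_mem_smul_top (s i).θ.toLinearMap (hF.minimal i ⟨_, rfl⟩)

/-- The standard grading underlying a multigrading. -/
def coarsen (F : GradedFreeComplex K (multiWeight n)) : GradedFreeComplex K (stdWeight n) where
  ι := F.ι
  finite_ι := F.finite_ι
  shift i j := ∑ l, F.shift i j l
  d := F.d
  d_comp_d := F.d_comp_d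
  d_homogeneous i _ _ hx := isFreeHomogeneous_linearMap
    (fun j => (F.d_homogeneous i _ _ (isFreeHomogeneous_basis _ _ j)).coarsen) hx

theorem IsMinimalResolution.coarsen {F : GradedFreeComplex K (multiWeight n)}
    {I : Ideal (MvPolynomial (Fin n) K)}
    {ε : (F.ι 0 →₀ MvPolynomial (Fin n) K) →ₗ[MvPolynomial (Fin n) K] (MvPolynomial (Fin n) K ⧸ I)}
    (hF : F.IsMinimalResolution I ε) : F.coarsen.IsMinimalResolution I ε where
  finite_length := hF.finite_length
  aug_homogeneous g x hx := by
    obtain ⟨φ, hφ, hφε⟩ := exists_homogeneous_lift ε hF.aug_homogeneous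
    refine ⟨φ x, ?_, hφε x⟩
    rw [← sub_zero g]
    refine isWeightedHomogeneous_linearMap (q := F.coarsen.shift 0) (fun j b hb => ?_) hx
    rw [weight_stdWeight, hφ _ _ (isFreeHomogeneous_basis _ _ j) hb, sub_zero]
    rfl
  aug_surjective := hF.aug_surjective
  exact_zero := hF.exact_zero
  exact_succ := hF.exact_succ
  minimal := hF.minimal

end GradedFreeComplex

end Refine

end

theorem lemma4p4 {K : Type*} [Field K] {n : ℕ} (I : Ideal (MvPolynomial (Fin n) K))
    (hI : IsMonomialIdeal I) (a : Fin n → ℤ) (ha : ∀ i, 0 ≤ a i) :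
    (∀ (F : GradedFreeComplex K (multiWeight n))
      (ε : (F.ι 0 →₀ MvPolynomial (Fin n) K) →ₗ[MvPolynomial (Fin n) K]
        (MvPolynomial (Fin n) K ⧸ I)),
      F.IsMinimalResolution I ε →
      ∃ η : ((F.restrictLE a).ι 0 →₀ MvPolynomial (Fin n) K) →ₗ[MvPolynomial (Fin n) K]
          (MvPolynomial (Fin n) K ⧸ idealLE I a),
        (F.restrictLE a).IsMinimalResolution (idealLE I a) η ∧
        ∀ x, Ideal.Quotient.factor (idealLE_le I a) (η x) = ε (F.inclLE a 0 x)) ∧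
    (HasLinearResolution I → HasLinearResolution (idealLE I a)) := by
  refine ⟨fun F ε hF => hF.restrictLE hI ha, ?_⟩
  rintro ⟨d, F, ε, hF, hlin⟩
  obtain ⟨E, ε', hE, hElin⟩ := hF.exists_multigraded hI hlin
  obtain ⟨η, hη, -⟩ := hE.restrictLE hI ha
  exact ⟨d, (E.restrictLE a).coarsen, η, hη.coarsen, fun i j => hElin i j.1⟩
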